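/- Let $A\in\mathbb{R}^{m\times n}$ have rows $a_1,\dots,a_m$ with $\|a_i\|=1$, let $b\in\mathbb{R}^m$ and $c_0\in\mathbb{R}^n$ with $\|c_0\|=1$ (Euclidean norms), and suppose that $P=\{x\in\mathbb{R}^n : Ax\le b\}$ is bounded and non-degenerate, i.e. exactly $n$ of the $m$ constraints are tight at every vertex of $P$. Let $\delta$ be the largest number such that for all $I\subseteq\{1,\dots,m\}$ and all $j$, $a_j\notin\operatorname{span}\{a_i : i\in I\}$ implies $\operatorname{dist}(a_j,\operatorname{span}\{a_i : i\in I\})\ge\delta$. Let $x_0$ be a basic feasible solution and let $u_1,\dots,u_n$ be linearly independent rows of $A$ that are tight at $x_0$. Let $\phi\ge\sqrt n$ and, for each $k$, let $I_k\subseteq[-1,1]$ be an interval of length $1/\phi$ that contains the $k$-th coordinate of $c_0$. Let $c\in\mathbb{R}^n$ have independent coordinates, the $k$-th one uniformly distributed on $I_k$; independently of $c$, let $\lambda$ be uniformly distributed on $(0,1]^n$, and put $w=-\sum_{k=1}^n\lambda_k u_k$. Let $P'=\{(w^{\mathrm T}x,\,c^{\mathrm T}x) : x\in P\}\subseteq\mathbb{R}^2$,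 and let $R_{w,c}$ be the path from the bottommost vertex of $P'$ to the rightmost vertex of $P'$ along the edges of the lower envelope of $P'$. Then for all $t\ge 0$ and $\varepsilon>0$, the probability that some edge of $R_{w,c}$ has a slope in $(t,t+\varepsilon]$ satisfies \[ \Pr\bigl[R_{w,c}\text{ has a slope in }(t,t+\varepsilon]\bigr] \;\le\; \frac{2mn^{3/2}\varepsilon\phi}{\max\{1,\tfrac{nt}{2}\}\cdot\delta} \;\le\; \frac{2mn^{3/2}\varepsilon\phi}{\delta}. \] -/

import Mathlib

open MeasureTheory ProbabilityTheory

namespace ShadowVertex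

noncomputable section

/-- The polyhedron `{x | A x ≤ b}`, where `a i` is the `i`-th row of `A`. -/
def polyhedron {m n : ℕ} (a : Fin m → EuclideanSpace ℝ (Fin n)) (b : Fin m → ℝ) :
    Set (EuclideanSpace ℝ (Fin n)) :=
  {x | ∀ i, inner ℝ (a i) x ≤ b i}

/-- Non-degeneracy: exactly `n` constraints are tight at every vertex of the polyhedron. -/
def Nondegenerate {m n : ℕ} (a : Fin m → EuclideanSpace ℝ (Fin n)) (b : Fin m → ℝ) : Prop :=
  ∀ x ∈ (polyhedron a b).extremePoints ℝ, {i : Fin m | inner ℝ (a i) x = b i}.ncard = n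

/-- The `δ`-distance property: every row outside the span of some rows has distance at least
`δ` from that span. -/
def DistanceProperty {m n : ℕ} (a : Fin m → EuclideanSpace ℝ (Fin n)) (δ : ℝ) : Prop :=
  ∀ (I : Set (Fin m)) (j : Fin m), a j ∉ Submodule.span ℝ (a '' I) →
    δ ≤ Metric.infDist (a j) (Submodule.span ℝ (a '' I) : Set (EuclideanSpace ℝ (Fin n)))

/-- The shadow `{(L₁ᵀx, L₂ᵀx) | x ∈ P}` of `P` in the plane. -/
def shadow {n : ℕ} (L₁ L₂ : EuclideanSpace ℝ (Fin n)) (P : Set (EuclideanSpace ℝ (Fin n))) :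
    Set (ℝ × ℝ) :=
  (fun x => (inner ℝ L₁ x, inner ℝ L₂ x)) '' P

/-- The lower envelope of a planar set: its points with no point of the set strictly below. -/
def lowerEnvelope (S : Set (ℝ × ℝ)) : Set (ℝ × ℝ) :=
  {p ∈ S | ∀ q ∈ S, q.1 = p.1 → p.2 ≤ q.2}

/-- A bottommost vertex of a planar polygon. -/
def IsBottommost (S : Set (ℝ × ℝ)) (p : ℝ × ℝ) : Prop :=
  p ∈ S.extremePoints ℝ ∧ ∀ q ∈ S, p.2 ≤ q.2

/-- A rightmost vertex of a planar polygon. -/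
def IsRightmost (S : Set (ℝ × ℝ)) (p : ℝ × ℝ) : Prop :=
  p ∈ S.extremePoints ℝ ∧ ∀ q ∈ S, q.1 ≤ p.1

/-- The point set of the path `R_{L₁,L₂}`: the part of the lower envelope of the shadow between
the bottommost and the rightmost vertex. (If there are two bottommost vertices, the horizontal
edge joining them is included; it has slope `0`.) -/
def path {n : ℕ} (L₁ L₂ : EuclideanSpace ℝ (Fin n)) (P : Set (EuclideanSpace ℝ (Fin n))) :
    Set (ℝ × ℝ) :=
  {p ∈ lowerEnvelope (shadow L₁ L₂ P) |
    ∃ q r, IsBottommost (shadow L₁ L₂ P) q ∧ IsRightmost (shadow L₁ L₂ P) r ∧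
      q.1 ≤ p.1 ∧ p.1 ≤ r.1}

/-- The segment from `p` to `q` is an edge (a one-dimensional face) of the planar polygon. -/
def IsEdge (S : Set (ℝ × ℝ)) (p q : ℝ × ℝ) : Prop :=
  p ≠ q ∧ IsExposed ℝ S (segment ℝ p q)

/-- `s` is the slope of an edge of the path `R_{L₁,L₂}`. Such an edge is never vertical, since
it lies on the lower envelope. -/
def HasSlope {n : ℕ} (L₁ L₂ : EuclideanSpace ℝ (Fin n)) (P : Set (EuclideanSpace ℝ (Fin n)))
    (s : ℝ) : Prop :=
  ∃ p q : ℝ × ℝ, IsEdge (shadow L₁ L₂ P) p q ∧ segment ℝ p q ⊆ path L₁ L₂ P ∧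
    s = (q.2 - p.2) / (q.1 - p.1)

/-- The objective `w = -∑ₖ λₖ uₖ`, where `u₁, …, uₙ` are the rows of `A` selected by `B`. -/
def objectiveW {m n : ℕ} (a : Fin m → EuclideanSpace ℝ (Fin n)) (B : Fin n → Fin m)
    (lam : Fin n → ℝ) : EuclideanSpace ℝ (Fin n) :=
  -∑ k, lam k • a (B k)

/-- The joint law of `(c, λ)`: the coordinates `cₖ` are uniform on `[lₖ, lₖ + 1/φ]`, `λ` is
uniform on `(0,1]ⁿ`, and everything is independent. -/
def randomLaw {n : ℕ} (l : Fin n → ℝ) (φ : ℝ) : Measure ((Fin n → ℝ) × (Fin n → ℝ)) :=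
  (Measure.pi fun k => ProbabilityTheory.cond volume (Set.Icc (l k) (l k + 1 / φ))).prod
    (Measure.pi fun _ => ProbabilityTheory.cond volume (Set.Ioc (0 : ℝ) 1))

end

end ShadowVertex

namespace ShadowVertex

open Filter Topology

variable {m n : ℕ} {a : Fin m → EuclideanSpace ℝ (Fin n)} {b : Fin m → ℝ}

/-! Let `C i` (`facetOptimal`) be the objectives minimized over `P` at a point of facet `i`. A slope
`s` in `(t, t + ε]` yields two minimizers of `c - s w`. Expand objectives in the basis of tight rows
at a vertex minimizing `c - t w`: every multiplier is `≤ 0` at `t`, and some multiplier, at row `i`,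
must be `≥ 0` at `s`. The distance property bounds its change, so at `t` it exceeds `-L`, where `L =
2εn / (max 1 (nt/2) δ)`. Hence `c - t w ∈ C i` but `c - t w + L a i ∉ C i`
(`exists_facetOptimal_of_hasSlope`).

`C i` is stable under subtracting nonnegative multiples of `a i`, so for fixed `λ` this event is a
boundary layer of a monotone set. Under the uniform law on a box such a layer has mass at most `φ L
∑ₖ |a i k| ≤ φ L √n` (`pi_cond_Icc_boundary_le`). A union bound over the `m` facets finishes; `λ`
matters only through `‖w‖ ≤ n`. -/

/-! ### Polyhedra, vertices and dual vectors -/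

lemma convex_polyhedron : Convex ℝ (polyhedron a b) := by
  intro x hx y hy s t hs ht hst i
  rw [inner_add_right, inner_smul_right, inner_smul_right]
  have h : b i = s * b i + t * b i := by rw [← add_mul, hst, one_mul]
  rw [h]
  exact add_le_add (mul_le_mul_of_nonneg_left (hx i) hs) (mul_le_mul_of_nonneg_left (hy i) ht)

lemma isClosed_polyhedron : IsClosed (polyhedron a b) := by
  have h : polyhedron a b = ⋂ i, {x | inner ℝ (a i) x ≤ b i} := by
    ext x; simp [polyhedron]
  rw [h]
  exact isClosed_iInter fun i => isClosed_le (by fun_prop) continuous_const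

lemma isCompact_polyhedron (hbdd : Bornology.IsBounded (polyhedron a b)) :
    IsCompact (polyhedron a b) :=
  Metric.isCompact_of_isClosed_isBounded isClosed_polyhedron hbdd

/-- A direction that does not increase any tight constraint is feasible for small steps. -/
lemma eventually_add_smul_mem {x d : EuclideanSpace ℝ (Fin n)} (hx : x ∈ polyhedron a b)
    (hd : ∀ j, inner ℝ (a j) x = b j → inner ℝ (a j) d ≤ 0) :
    ∀ᶠ η in 𝓝[>] (0 : ℝ), x + η • d ∈ polyhedron a b := by
  have key : ∀ j, ∀ᶠ η in 𝓝[>] (0 : ℝ), inner ℝ (a j) (x + η • d) ≤ b j := by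
    intro j
    rcases (hx j).eq_or_lt with h | h
    · filter_upwards [self_mem_nhdsWithin] with η hη
      rw [inner_add_right, inner_smul_right, h]
      nlinarith [hd j h, Set.mem_Ioi.1 hη]
    · have hc : Continuous fun η : ℝ => (inner ℝ (a j) (x + η • d) : ℝ) := by fun_prop
      have h0 : ∀ᶠ η in 𝓝 (0 : ℝ), (inner ℝ (a j) (x + η • d) : ℝ) < b j :=
        hc.continuousAt.eventually_lt continuousAt_const (by simpa using h)
      exact (h0.filter_mono nhdsWithin_le_nhds).mono fun η hη => hη.le
  exact (eventually_all.2 key).mono fun η hη => hη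

/-- The rows tight at a vertex of a non-degenerate polyhedron form a basis. -/
lemma exists_basis_tight (hnd : Nondegenerate a b) {x : EuclideanSpace ℝ (Fin n)}
    (hx : x ∈ (polyhedron a b).extremePoints ℝ) :
    ∃ e : Module.Basis {i // inner ℝ (a i) x = b i} ℝ (EuclideanSpace ℝ (Fin n)),
      ∀ j, e j = a j := by
  classical
  set T := {i : Fin m // inner ℝ (a i) x = b i}
  have hspan : Submodule.span ℝ (Set.range fun j : T => a j) = ⊤ := by
    -- If `d` is orthogonal to all tight rows, both `x ± η d` are feasible, so extremality forces `d
    -- = 0`.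
    rw [← Submodule.orthogonal_eq_bot_iff, Submodule.eq_bot_iff]
    intro d hd
    have hd' : ∀ j, inner ℝ (a j) x = b j → inner ℝ (a j) d = 0 := fun j hj =>
      (Submodule.mem_orthogonal _ _).1 hd _ (Submodule.subset_span ⟨⟨j, hj⟩, rfl⟩)
    have h1 := eventually_add_smul_mem hx.1 fun j hj => (hd' j hj).le
    have h2 := eventually_add_smul_mem (d := -d) hx.1 fun j hj => by
      rw [inner_neg_right, hd' j hj, neg_zero]
    obtain ⟨η, ⟨h1, h2⟩, hη⟩ := ((h1.and h2).and self_mem_nhdsWithin).exists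
    have h3 : x ∈ openSegment ℝ (x + η • d) (x + η • -d) :=
      ⟨1 / 2, 1 / 2, by norm_num, by norm_num, by norm_num, by module⟩
    have h4 : x + η • d = x := hx.2 h1 h2 h3
    exact (smul_eq_zero.1 (add_eq_left.1 h4)).resolve_left (ne_of_gt hη)
  have hcard : Fintype.card T = Module.finrank ℝ (EuclideanSpace ℝ (Fin n)) := by
    rw [finrank_euclideanSpace_fin, ← Nat.card_eq_fintype_card]
    exact hnd x hx
  exact ⟨basisOfTopLeSpanOfCardEqFinrank _ hspan.ge hcard, fun j => by simp⟩

/-- The component of a basis vector orthogonal to the span of the other basis vectors. -/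
lemma exists_orthogonal_component {δ : ℝ} (hδ : DistanceProperty a δ) {p : Fin m → Prop}
    (e : Module.Basis {i // p i} ℝ (EuclideanSpace ℝ (Fin n))) (he : ∀ j, e j = a j)
    (i : {i // p i}) :
    ∃ u : EuclideanSpace ℝ (Fin n), δ ≤ ‖u‖ ∧ 0 < ‖u‖ ∧
      (∀ j : {i // p i}, j ≠ i → inner ℝ (a j) u = 0) ∧ inner ℝ (a i) u = ‖u‖ ^ 2 := by
  set I : Set (Fin m) := {j | p j ∧ j ≠ i} with hI
  set U := Submodule.span ℝ (a '' I) with hU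
  have himg : a '' I = e '' {i}ᶜ := by
    ext v
    constructor
    · rintro ⟨j, ⟨hj, hji⟩, rfl⟩
      exact ⟨⟨j, hj⟩, fun h => hji (congrArg Subtype.val h), he _⟩
    · rintro ⟨j, hj, rfl⟩
      exact ⟨j, ⟨j.2, fun h => hj (Subtype.ext h)⟩, (he j).symm⟩
  have hnot : a i ∉ U := by
    rw [hU, himg, ← he i]
    exact e.linearIndependent.notMem_span_image (by simp)
  have hu := U.sub_starProjection_mem_orthogonal (a i)
  have hp := U.starProjection_apply_mem (a i)
  set u := a i - U.starProjection (a i) with hudef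
  refine ⟨u, ?_, ?_, ?_, ?_⟩
  · refine (hδ I i hnot).trans ((Metric.infDist_le_dist_of_mem hp).trans_eq ?_)
    rw [dist_eq_norm]
  · rw [norm_pos_iff]
    intro h0
    exact hnot (sub_eq_zero.1 h0 ▸ hp)
  · intro j hj
    exact (Submodule.mem_orthogonal _ _).1 hu _
      (Submodule.subset_span ⟨j, ⟨j.2, fun h => hj (Subtype.ext h)⟩, rfl⟩)
  · have h1 : a i = u + U.starProjection (a i) := by rw [hudef]; abel
    rw [h1, inner_add_left, (Submodule.mem_orthogonal _ _).1 hu _ hp, add_zero,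
      real_inner_self_eq_norm_sq]

lemma exists_extremePoint_minimizer (hbdd : Bornology.IsBounded (polyhedron a b))
    (hne : (polyhedron a b).Nonempty) (z : EuclideanSpace ℝ (Fin n)) :
    ∃ x ∈ (polyhedron a b).extremePoints ℝ, ∀ y ∈ polyhedron a b, inner ℝ z x ≤ inner ℝ z y := by
  have hc := isCompact_polyhedron hbdd
  obtain ⟨x₁, hx₁, hmin⟩ := hc.exists_isMinOn hne
    (f := fun x => (inner ℝ z x : ℝ)) (by fun_prop)
  let f : StrongDual ℝ (EuclideanSpace ℝ (Fin n)) := -(innerSL ℝ z)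
  have hf : ∀ x, f x = -inner ℝ z x := fun x => rfl
  have hexp : IsExposed ℝ (polyhedron a b)
      {x ∈ polyhedron a b | ∀ y ∈ polyhedron a b, f y ≤ f x} := fun _ => ⟨f, rfl⟩
  have hF := hexp.isCompact hc
  obtain ⟨x, hx⟩ := hF.extremePoints_nonempty ⟨x₁, hx₁, fun y hy => by
    rw [hf, hf]; exact neg_le_neg (hmin hy)⟩
  refine ⟨x, hexp.isExtreme.extremePoints_subset_extremePoints hx, fun y hy => ?_⟩
  have := hx.1.2 y hy
  rw [hf, hf] at this
  linarith

/-! ### Objectives optimal on a facet -/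

/-- The objectives that are minimized somewhere on the `i`-th facet. -/
def facetOptimal (a : Fin m → EuclideanSpace ℝ (Fin n)) (b : Fin m → ℝ) (i : Fin m) :
    Set (EuclideanSpace ℝ (Fin n)) :=
  {z | ∃ x ∈ polyhedron a b, inner ℝ (a i) x = b i ∧
    ∀ y ∈ polyhedron a b, inner ℝ z x ≤ inner ℝ z y}

/-- The row `a i` attains its maximum over the polyhedron on facet `i`, so subtracting `r • a i`
only favours points of that facet. -/
lemma facetOptimal_of_add_smul {i : Fin m} {r : ℝ} (hr : 0 ≤ r) {z : EuclideanSpace ℝ (Fin n)}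
    (hz : z + r • a i ∈ facetOptimal a b i) : z ∈ facetOptimal a b i := by
  obtain ⟨x, hx, hxi, hmin⟩ := hz
  refine ⟨x, hx, hxi, fun y hy => ?_⟩
  have h := hmin y hy
  simp only [inner_add_left, real_inner_smul_left] at h
  nlinarith [hy i]

/-- Projecting along the compact facet is a closed map. Needed for measurability. -/
lemma isClosed_facetOptimal (hbdd : Bornology.IsBounded (polyhedron a b)) (i : Fin m) :
    IsClosed (facetOptimal a b i) := by
  have hF : IsCompact {x ∈ polyhedron a b | inner ℝ (a i) x = b i} :=
    (isCompact_polyhedron hbdd).inter_right (isClosed_eq (by fun_prop) continuous_const)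
  have := isCompact_iff_compactSpace.1 hF
  have hcl : IsClosed {q : EuclideanSpace ℝ (Fin n) × {x ∈ polyhedron a b | inner ℝ (a i) x = b i} |
      ∀ y ∈ polyhedron a b, (inner ℝ q.1 (q.2 : EuclideanSpace ℝ (Fin n)) : ℝ) ≤ inner ℝ q.1 y} := by
    simp only [Set.ofPred_forall]
    exact isClosed_iInter fun y => isClosed_iInter fun _ => isClosed_le (by fun_prop) (by fun_prop)
  convert isClosedMap_fst_of_compactSpace _ hcl using 1
  ext z
  constructor
  · rintro ⟨x, hx, hxi, hmin⟩
    exact ⟨(z, ⟨x, hx, hxi⟩), hmin, rfl⟩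
  · rintro ⟨⟨z', x⟩, hmin, rfl⟩
    exact ⟨x, x.2.1, x.2.2, hmin⟩

/-! ### From a slope to a facet -/

/-- An edge of slope `s` on the lower envelope comes from two distinct minimizers
of `c - s w`. -/
lemma HasSlope.exists_minimizers {w c : EuclideanSpace ℝ (Fin n)} {s : ℝ}
    (h : HasSlope w c (polyhedron a b) s) (hs : s ≠ 0) :
    ∃ x ∈ polyhedron a b, ∃ y ∈ polyhedron a b, x ≠ y ∧
      (∀ z ∈ polyhedron a b, inner ℝ (c - s • w) x ≤ inner ℝ (c - s • w) z) ∧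
      inner ℝ (c - s • w) x = inner ℝ (c - s • w) y := by
  obtain ⟨p, q, -, hsub, hslope⟩ := h
  have henv : ∀ r ∈ segment ℝ p q, r ∈ lowerEnvelope (shadow w c (polyhedron a b)) :=
    fun r hr => (hsub hr).1
  -- Division by zero would give a vertical segment slope `0`, which `hs` excludes.
  have hpq : q.1 - p.1 ≠ 0 := by
    intro h0
    rw [h0, div_zero] at hslope
    exact hs hslope
  obtain ⟨x, hx, hxp⟩ := (henv p (left_mem_segment ℝ p q)).1
  obtain ⟨y, hy, hyq⟩ := (henv q (right_mem_segment ℝ p q)).1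
  have hline : q.2 - p.2 = s * (q.1 - p.1) := by rw [hslope]; field_simp
  have e1 : inner ℝ w x = p.1 := congrArg Prod.fst hxp
  have e2 : inner ℝ c x = p.2 := congrArg Prod.snd hxp
  have e3 : inner ℝ w y = q.1 := congrArg Prod.fst hyq
  have e4 : inner ℝ c y = q.2 := congrArg Prod.snd hyq
  refine ⟨x, hx, y, hy, ?_, ?_, ?_⟩
  · rintro rfl
    exact hpq (by rw [← e1, ← e3, sub_self])
  · intro z hz
    by_contra! hlt
    simp only [inner_sub_left, real_inner_smul_left, e1, e2] at hlt
    -- Move from the midpoint of the edge slightly towards the image of `z`.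
    obtain ⟨η, hη0, hη1, hηr⟩ : ∃ η : ℝ, 0 < η ∧ η < 1 ∧
        |η * ((inner ℝ w z - (p.1 + q.1) / 2) / (q.1 - p.1))| ≤ 1 / 2 := by
      set ρ := (inner ℝ w z - (p.1 + q.1) / 2) / (q.1 - p.1)
      refine ⟨1 / (2 * (1 + |ρ|)), by positivity, ?_, ?_⟩
      · rw [div_lt_one (by positivity)]
        nlinarith [abs_nonneg ρ]
      · rw [abs_mul, abs_of_pos (by positivity), div_mul_eq_mul_div, one_mul,
          div_le_div_iff₀ (by positivity) (by norm_num)]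
        nlinarith [abs_nonneg ρ]
    set ρ := (inner ℝ w z - (p.1 + q.1) / 2) / (q.1 - p.1) with hρ
    have hρ' : inner ℝ w z = (p.1 + q.1) / 2 + ρ * (q.1 - p.1) := by
      rw [hρ, div_mul_cancel₀ _ hpq]; ring
    obtain ⟨hl, hr⟩ := abs_le.1 hηr
    -- This point of the edge has the same abscissa as the image of the perturbed point `hv`, which
    -- would lie strictly below it.
    have hmem : (1 / 2 - η * ρ) • p + (1 / 2 + η * ρ) • q ∈ segment ℝ p q :=
      ⟨_, _, by linarith, by linarith, by ring, rfl⟩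
    have hv : (1 - η) • ((1 / 2 : ℝ) • x + (1 / 2 : ℝ) • y) + η • z ∈ polyhedron a b :=
      convex_polyhedron (convex_polyhedron hx hy (by norm_num) (by norm_num) (by norm_num)) hz
        (by linarith) hη0.le (by ring)
    have hle := (henv _ hmem).2 _ ⟨_, hv, rfl⟩ (by
      simp only [inner_add_right, real_inner_smul_right, Prod.fst_add, Prod.smul_fst, smul_eq_mul,
        e1, e3, hρ']
      ring)
    simp only [inner_add_right, real_inner_smul_right, Prod.snd_add, Prod.smul_snd, smul_eq_mul,
        e2, e4] at hle
    have hq2 : q.2 = p.2 + s * (q.1 - p.1) := by linarith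
    rw [hρ'] at hlt
    rw [hq2] at hle
    nlinarith
  · simp only [inner_sub_left, real_inner_smul_left, e1, e2, e3, e4]
    linarith

/-- If the path has a slope in `(t, t + ε]`, then `c - t w` is close to the boundary of the set of
objectives that are optimal on some facet, in the direction of the normal of that facet. -/
lemma exists_facetOptimal_of_hasSlope (hbdd : Bornology.IsBounded (polyhedron a b))
    (hnd : Nondegenerate a b) {δ : ℝ} (hδ : DistanceProperty a δ) (hδ0 : 0 < δ)
    {w c : EuclideanSpace ℝ (Fin n)} {t ε s M N L : ℝ} (ht : 0 ≤ t) (hs : s ∈ Set.Ioc t (t + ε))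
    (hw : ‖w‖ ≤ N) (hc : ‖c‖ ≤ M) (hL : ∀ W, 0 ≤ W → W ≤ N → t * W ≤ M → ε * W < L * δ)
    (hslope : HasSlope w c (polyhedron a b) s) :
    ∃ i, c - t • w ∈ facetOptimal a b i ∧ c - t • w + L • a i ∉ facetOptimal a b i := by
  classical
  obtain ⟨hts, hsε⟩ := hs
  obtain ⟨x₁, hx₁, x₂, hx₂, hne, hmin, heq⟩ := hslope.exists_minimizers (ht.trans_lt hts).ne'
  obtain ⟨x, hx, hxmin⟩ := exists_extremePoint_minimizer hbdd ⟨x₁, hx₁⟩ (c - t • w)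
  obtain ⟨e, he⟩ := exists_basis_tight hnd hx
  choose u hδu hu0 hortho hself using exists_orthogonal_component hδ e he
  -- `u j` is dual to `a j` up to a positive factor.
  have hrepr : ∀ (z : EuclideanSpace ℝ (Fin n)) (i), inner ℝ z (u i) = e.repr z i * ‖u i‖ ^ 2 := by
    intro z i
    conv_lhs => rw [← e.sum_repr z]
    rw [sum_inner, Finset.sum_eq_single i]
    · rw [real_inner_smul_left, he, hself]
    · intro j _ hj
      rw [real_inner_smul_left, he, hortho i j hj, mul_zero]
    · simp
  have hgap : ∀ (z y : EuclideanSpace ℝ (Fin n)),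
      inner ℝ z y - inner ℝ z x = ∑ j, e.repr z j * (inner ℝ (a j) y - b j) := by
    intro z y
    rw [← inner_sub_right]
    conv_lhs => rw [← e.sum_repr z]
    rw [sum_inner]
    refine Finset.sum_congr rfl fun j _ => ?_
    rw [real_inner_smul_left, he, inner_sub_right, j.2]
  -- The direction `-u i` leaves constraint `i` and keeps the other tight ones tight.
  have hfeas : ∀ i, ∃ η : ℝ, 0 < η ∧ x + η • -u i ∈ polyhedron a b := by
    intro i
    obtain ⟨η, h1, h2⟩ := ((eventually_add_smul_mem (d := -u i) hx.1 fun j hj => by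
      rw [inner_neg_right, neg_nonpos]
      by_cases hji : (⟨j, hj⟩ : {i // inner ℝ (a i) x = b i}) = i
      · have : inner ℝ (a j) (u i) = ‖u i‖ ^ 2 := by rw [← hself i, ← hji]
        rw [this]; positivity
      · exact (hortho i ⟨j, hj⟩ hji).ge).and self_mem_nhdsWithin).exists
    exact ⟨η, h2, h1⟩
  -- The multipliers at `x` for `c - t w` have the right sign.
  have hsign : ∀ i, e.repr (c - t • w) i ≤ 0 := by
    intro i
    obtain ⟨η, hη, hmem⟩ := hfeas i
    have h := hxmin _ hmem
    rw [inner_add_right, real_inner_smul_right, inner_neg_right, hrepr] at h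
    by_contra! hpos
    have : 0 < η * (e.repr (c - t • w) i * ‖u i‖ ^ 2) :=
      mul_pos hη (mul_pos hpos (pow_pos (hu0 i) 2))
    linarith
  -- Some multiplier changes its sign between `t` and `s`.
  obtain ⟨i, hi⟩ : ∃ i, 0 ≤ e.repr (c - s • w) i := by
    -- With all multipliers negative, complementary slackness makes `x` the unique minimizer of `c -
    -- s w`.
    by_contra! hneg
    have huniq : ∀ y ∈ polyhedron a b, inner ℝ (c - s • w) y ≤ inner ℝ (c - s • w) x → y = x := by
      intro y hy hle
      have hnn : ∀ j ∈ Finset.univ, 0 ≤ e.repr (c - s • w) j * (inner ℝ (a j) y - b j) :=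
        fun j _ => mul_nonneg_of_nonpos_of_nonpos (hneg j).le (sub_nonpos.2 (hy j))
      have hsum := hgap (c - s • w) y
      have hz := (Finset.sum_eq_zero_iff_of_nonneg hnn).1
        (le_antisymm (by linarith) (Finset.sum_nonneg hnn))
      refine InnerProductSpace.ext_inner_left_basis e fun j => ?_
      have := (mul_eq_zero.1 (hz j (Finset.mem_univ j))).resolve_left (hneg j).ne
      rw [he, j.2, sub_eq_zero.1 this]
    exact hne ((huniq x₁ hx₁ (hmin x hx.1)).trans
      (huniq x₂ hx₂ (heq ▸ hmin x hx.1)).symm)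
  set r := -e.repr (c - t • w) i with hr
  have hr0 : 0 ≤ r := neg_nonneg.2 (hsign i)
  -- The multiplier at `t` is small.
  have hrL : r < L := by
    have h1 : inner ℝ (c - t • w) (u i) = -r * ‖u i‖ ^ 2 := by rw [hrepr, hr, neg_neg]
    have h2 : 0 ≤ inner ℝ (c - s • w) (u i) := by
      rw [hrepr]; positivity
    rw [inner_sub_left, real_inner_smul_left] at h1 h2
    -- `W` is the component of `-w` along `u i`. Besides `W ≤ ‖w‖`, the sign of the multiplier at
    -- `t` gives `t W ≤ ‖c‖`, the source of the gain for large `t`.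
    set W := -inner ℝ w (u i) / ‖u i‖ with hW
    have hWu : W * ‖u i‖ = -inner ℝ w (u i) := div_mul_cancel₀ _ (hu0 i).ne'
    have hst : 0 < s - t := sub_pos.2 hts
    have hrW : r * ‖u i‖ ^ 2 ≤ (s - t) * (W * ‖u i‖) := by rw [hWu]; linarith
    have hrW' : r * ‖u i‖ ≤ (s - t) * W := by
      refine le_of_mul_le_mul_right ?_ (hu0 i)
      linarith
    have hW0 : 0 ≤ W := by
      have : 0 ≤ (s - t) * W := (mul_nonneg hr0 (hu0 i).le).trans hrW'
      exact nonneg_of_mul_nonneg_right this hst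
    have hWN : W ≤ N := by
      rw [hW, div_le_iff₀ (hu0 i)]
      have := abs_real_inner_le_norm w (u i)
      have := neg_abs_le (inner ℝ w (u i) : ℝ)
      nlinarith [hu0 i]
    have htW : t * W ≤ M := by
      refine le_of_mul_le_mul_right ?_ (hu0 i)
      have := abs_real_inner_le_norm c (u i)
      have := neg_abs_le (inner ℝ c (u i) : ℝ)
      have : 0 ≤ r * ‖u i‖ ^ 2 := by positivity
      nlinarith [hu0 i]
    have h3 := hL W hW0 hWN htW
    have h4 : r * δ ≤ ε * W :=
      (mul_le_mul_of_nonneg_left (hδu i) hr0).trans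
        (hrW'.trans (mul_le_mul_of_nonneg_right (by linarith) hW0))
    exact lt_of_mul_lt_mul_right (h4.trans_lt h3) hδ0.le
  refine ⟨i, ⟨x, hx.1, i.2, hxmin⟩, ?_⟩
  -- Adding `L • a i` turns the multiplier into `L - r > 0`, so moving from `x` along `-u i` beats
  -- every point of the facet.
  rintro ⟨y, hy, hyi, hymin⟩
  obtain ⟨η, hη, hmem⟩ := hfeas i
  have h1 := hymin _ hmem
  have h2 : 0 ≤ inner ℝ (c - t • w) y - inner ℝ (c - t • w) x := sub_nonneg.2 (hxmin y hy)
  have h3 : inner ℝ (c - t • w) (u i) = -r * ‖u i‖ ^ 2 := by rw [hrepr, hr, neg_neg]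
  simp only [inner_add_left, inner_add_right, real_inner_smul_left, real_inner_smul_right,
    inner_neg_right, hself, hyi, i.2, h3] at h1
  have h4 : 0 < (L - r) * (η * ‖u i‖ ^ 2) :=
    mul_pos (sub_pos.2 hrL) (mul_pos hη (pow_pos (hu0 i) 2))
  nlinarith

/-! ### Bounds on `δ`, `w` and `c` -/

lemma distance_pos {δ : ℝ} (hδ : IsGreatest {δ' : ℝ | DistanceProperty a δ'} δ) :
    0 < δ := by
  classical
  -- The value `1` is a positive filler for pairs the distance property ignores; finiteness then
  -- gives a positive minimum.
  let f : Set (Fin m) × Fin m → ℝ := fun q =>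
    if a q.2 ∈ Submodule.span ℝ (a '' q.1) then 1 else
      Metric.infDist (a q.2) (Submodule.span ℝ (a '' q.1) : Set (EuclideanSpace ℝ (Fin n)))
  have hf : ∀ q, 0 < f q := by
    intro q
    by_cases h : a q.2 ∈ Submodule.span ℝ (a '' q.1)
    · simp [f, h]
    · simp only [f, h, if_false]
      exact ((Submodule.closed_of_finiteDimensional _).notMem_iff_infDist_pos ⟨0, zero_mem _⟩).1 h
  obtain ⟨ε, hε, hεf⟩ : ∃ ε > 0, ∀ q, ε ≤ f q := by
    rcases isEmpty_or_nonempty (Set (Fin m) × Fin m) with h | h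
    · exact ⟨1, one_pos, fun q => h.elim q⟩
    · obtain ⟨q, hq⟩ := Finite.exists_min f
      exact ⟨f q, hf q, hq⟩
  refine hε.trans_le (hδ.2 fun I j hj => ?_)
  have := hεf (I, j)
  simpa only [f, hj, if_false] using this

lemma norm_objectiveW_le (ha : ∀ i, ‖a i‖ = 1) (B : Fin n → Fin m) {lam : Fin n → ℝ}
    (hlam : ∀ k, lam k ∈ Set.Ioc (0 : ℝ) 1) : ‖objectiveW a B lam‖ ≤ n := by
  rw [objectiveW, norm_neg]
  refine (norm_sum_le _ _).trans ((Finset.sum_le_card_nsmul _ _ 1 fun k _ => ?_).trans_eq (by simp))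
  rw [norm_smul, ha, mul_one, Real.norm_eq_abs, abs_of_pos (hlam k).1]
  exact (hlam k).2

/-- Both `c` and `c₀` lie in a box of side `1/φ`, whose diameter `√n/φ` is at most `1`. -/
lemma norm_le_two {c₀ : EuclideanSpace ℝ (Fin n)} (hc₀ : ‖c₀‖ = 1) {φ : ℝ} (hφ0 : 0 < φ)
    (hφ : √(n : ℝ) ≤ φ) {l : Fin n → ℝ} (hlc₀ : ∀ k, c₀ k ∈ Set.Icc (l k) (l k + 1 / φ))
    {c : Fin n → ℝ} (hc : ∀ k, c k ∈ Set.Icc (l k) (l k + 1 / φ)) :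
    ‖(WithLp.toLp 2 c : EuclideanSpace ℝ (Fin n))‖ ≤ 2 := by
  have h1 : ‖(WithLp.toLp 2 c : EuclideanSpace ℝ (Fin n)) - c₀‖ ≤ 1 := by
    rw [EuclideanSpace.norm_eq, Real.sqrt_le_one]
    calc ∑ k, ‖((WithLp.toLp 2 c : EuclideanSpace ℝ (Fin n)) - c₀) k‖ ^ 2
        ≤ ∑ k : Fin n, (1 / φ) ^ 2 := by
          refine Finset.sum_le_sum fun k _ => pow_le_pow_left₀ (norm_nonneg _) ?_ 2
          rw [Real.norm_eq_abs]
          simp only [PiLp.sub_apply]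
          have := hc k
          have := hlc₀ k
          simp only [Set.mem_Icc] at *
          rw [abs_le]
          constructor <;> linarith
      _ = n / φ ^ 2 := by simp [div_eq_mul_inv]
      _ ≤ 1 := by
          rw [div_le_one (by positivity)]
          exact (Real.sqrt_le_left hφ0.le).1 hφ
  calc _ = ‖((WithLp.toLp 2 c : EuclideanSpace ℝ (Fin n)) - c₀) + c₀‖ := by rw [sub_add_cancel]
    _ ≤ 2 := (norm_add_le _ _).trans (by rw [hc₀]; linarith)

/-! ### Uniform laws on boxes -/

lemma cond_Icc_eq {l φ : ℝ} (hφ : 0 < φ) :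
    (cond volume (Set.Icc l (l + 1 / φ)) : Measure ℝ) =
      ENNReal.ofReal φ • volume.restrict (Set.Icc l (l + 1 / φ)) := by
  rw [ProbabilityTheory.cond, Real.volume_Icc, add_sub_cancel_left, one_div,
    ENNReal.ofReal_inv_of_pos hφ, inv_inv]

lemma isProbabilityMeasure_cond_Icc {l φ : ℝ} (hφ : 0 < φ) :
    IsProbabilityMeasure (cond volume (Set.Icc l (l + 1 / φ)) : Measure ℝ) :=
  cond_isProbabilityMeasure_of_finite (by simp [hφ]) (by simp)

lemma cond_Icc_shift_le {l φ v : ℝ} (hφ : 0 < φ) :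
    (cond volume (Set.Icc l (l + 1 / φ)) : Measure ℝ) {x | x - v ∉ Set.Icc l (l + 1 / φ)} ≤
      ENNReal.ofReal (φ * |v|) := by
  rw [cond_Icc_eq hφ, Measure.smul_apply, smul_eq_mul, ENNReal.ofReal_mul hφ.le]
  refine mul_le_mul_right ?_ _
  rw [Measure.restrict_apply' measurableSet_Icc]
  rcases le_total 0 v with hv | hv
  · calc _ ≤ volume (Set.Icc l (l + v)) := measure_mono ?_
      _ = ENNReal.ofReal |v| := by rw [Real.volume_Icc, add_sub_cancel_left, abs_of_nonneg hv]
    rintro x ⟨h1, h2, h3⟩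
    refine ⟨h2, ?_⟩
    by_contra! h
    exact h1 ⟨by linarith, by linarith⟩
  · calc _ ≤ volume (Set.Icc (l + 1 / φ + v) (l + 1 / φ)) := measure_mono ?_
      _ = ENNReal.ofReal |v| := by rw [Real.volume_Icc, abs_of_nonpos hv]; congr 1; ring
    rintro x ⟨h1, h2, h3⟩
    refine ⟨?_, h3⟩
    by_contra! h
    exact h1 ⟨by linarith, by linarith⟩

lemma pi_cond_Icc_eq (l : Fin n → ℝ) {φ : ℝ} (hφ : 0 < φ) :
    (Measure.pi fun k => cond volume (Set.Icc (l k) (l k + 1 / φ)) : Measure (Fin n → ℝ)) =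
      ENNReal.ofReal φ ^ n •
        volume.restrict (Set.univ.pi fun k => Set.Icc (l k) (l k + 1 / φ)) := by
  have := fun k => isProbabilityMeasure_cond_Icc (l := l k) hφ
  refine Measure.pi_eq fun s hs => ?_
  rw [volume_pi, Measure.restrict_pi_pi, Measure.smul_apply, Measure.pi_pi]
  simp only [cond_Icc_eq hφ, Measure.smul_apply, smul_eq_mul, Finset.prod_mul_distrib,
    Finset.prod_const, Finset.card_univ, Fintype.card_fin]

/-- The law of a uniform point of a cube gives a set that is stable under translation by `-v`
little mass near its boundary in direction `v`. -/
lemma pi_cond_Icc_boundary_le (l : Fin n → ℝ) {φ : ℝ} (hφ : 0 < φ) {D : Set (Fin n → ℝ)}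
    (hD : MeasurableSet D) (v : Fin n → ℝ) (hDv : ∀ z, z + v ∈ D → z ∈ D) :
    (Measure.pi fun k => cond volume (Set.Icc (l k) (l k + 1 / φ)) : Measure (Fin n → ℝ))
      {z | z ∈ D ∧ z + v ∉ D} ≤ ∑ k, ENNReal.ofReal (φ * |v k|) := by
  have := fun k => isProbabilityMeasure_cond_Icc (l := l k) hφ
  set ν := (Measure.pi fun k => cond volume (Set.Icc (l k) (l k + 1 / φ)) : Measure (Fin n → ℝ))
  set K := Set.univ.pi fun k => Set.Icc (l k) (l k + 1 / φ) with hK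
  have hKm : MeasurableSet K := MeasurableSet.univ_pi fun k => measurableSet_Icc
  have hνeq : ν = ENNReal.ofReal φ ^ n • volume.restrict K := pi_cond_Icc_eq l hφ
  set D' := {z | z + v ∈ D} with hD'
  have hD'm : MeasurableSet D' := (measurable_add_const v) hD
  have hdiff : {z | z ∈ D ∧ z + v ∉ D} = D \ D' := rfl
  have hout : ν {z | z - v ∉ K} ≤ ∑ k, ENNReal.ofReal (φ * |v k|) := by
    have hsub : {z | z - v ∉ K} ⊆
        ⋃ k, Function.eval k ⁻¹' {x | x - v k ∉ Set.Icc (l k) (l k + 1 / φ)} := by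
      intro z hz
      by_contra h
      exact hz fun k _ => not_not.1 fun hk => h (Set.mem_iUnion.2 ⟨k, hk⟩)
    refine (measure_mono hsub).trans ((measure_iUnion_fintype_le _ _).trans
      (Finset.sum_le_sum fun k _ => ?_))
    have hmeas : MeasurableSet {x : ℝ | x - v k ∉ Set.Icc (l k) (l k + 1 / φ)} :=
      (measurable_sub_const (v k) measurableSet_Icc).compl
    rw [(measurePreserving_eval _ k).measure_preimage hmeas.nullMeasurableSet]
    exact cond_Icc_shift_le hφ
  -- Translation by `-v` maps the part inside `K` into `D' ∩ K`, and the density is constant on `K`.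
  have hin : ν (D ∩ {z | z - v ∈ K}) ≤ ν D' := by
    rw [hνeq, Measure.smul_apply, Measure.smul_apply]
    refine mul_le_mul_right ?_ _
    rw [Measure.restrict_apply' hKm, Measure.restrict_apply' hKm,
      ← measure_preimage_add_right volume (-v) (D' ∩ K)]
    refine measure_mono ?_
    rintro z ⟨⟨h1, h2⟩, -⟩
    rw [Set.mem_ofPred, sub_eq_add_neg] at h2
    refine ⟨?_, h2⟩
    change z + -v + v ∈ D
    rwa [neg_add_cancel_right]
  have htot : ν D ≤ (∑ k, ENNReal.ofReal (φ * |v k|)) + ν D' := by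
    rw [add_comm]
    refine (measure_mono ?_).trans ((measure_union_le _ _).trans (add_le_add hin hout))
    intro z hz
    by_cases h : z - v ∈ K
    · exact Or.inl ⟨hz, h⟩
    · exact Or.inr h
  have hsub : D' ⊆ D := fun z hz => hDv z hz
  rw [hdiff, measure_sdiff hsub hD'm.nullMeasurableSet (measure_ne_top _ _)]
  exact tsub_le_iff_right.2 htot

lemma sum_abs_le_sqrt {v : EuclideanSpace ℝ (Fin n)} (hv : ‖v‖ = 1) : ∑ k, |v k| ≤ √(n : ℝ) := by
  refine Real.le_sqrt_of_sq_le ?_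
  have h := sq_sum_le_card_mul_sum_sq (s := Finset.univ) (f := fun k => |v k|)
  have h2 : ∑ k, |v k| ^ 2 = 1 := by
    have := EuclideanSpace.norm_sq_eq v
    rw [hv] at this
    simpa using this.symm
  rw [h2] at h
  simpa using h

lemma isProbabilityMeasure_cond_Ioc :
    IsProbabilityMeasure (cond volume (Set.Ioc (0 : ℝ) 1) : Measure ℝ) :=
  cond_isProbabilityMeasure_of_finite (by simp) (by simp)

lemma ae_pi_cond_mem {s : Fin n → Set ℝ} (hs : ∀ k, MeasurableSet (s k))
    [∀ k, IsProbabilityMeasure (cond volume (s k) : Measure ℝ)] :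
    ∀ᵐ x ∂(Measure.pi fun k => (cond volume (s k) : Measure ℝ)), ∀ k, x k ∈ s k :=
  ae_all_iff.2 fun k =>
    (measurePreserving_eval (fun k => (cond volume (s k) : Measure ℝ)) k).quasiMeasurePreserving.ae
      (ae_cond_mem (hs k))

/-! ### Probability for one facet and the union bound -/

lemma continuous_objectiveW (a : Fin m → EuclideanSpace ℝ (Fin n)) (B : Fin n → Fin m) :
    Continuous (objectiveW a B) := by
  unfold objectiveW
  fun_prop

/-- By Fubini it suffices to bound the `c`-probability uniformly in `λ`. -/
lemma randomLaw_facetOptimal_le (hbdd : Bornology.IsBounded (polyhedron a b)) (ha : ∀ i, ‖a i‖ = 1) (B : Fin n → Fin m)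
    (l : Fin n → ℝ) {φ : ℝ} (hφ : 0 < φ) (t : ℝ) {L : ℝ} (hL : 0 ≤ L) (i : Fin m) :
    randomLaw l φ {ω | WithLp.toLp 2 ω.1 - t • objectiveW a B ω.2 ∈ facetOptimal a b i ∧
        WithLp.toLp 2 ω.1 - t • objectiveW a B ω.2 + L • a i ∉ facetOptimal a b i} ≤
      ENNReal.ofReal (φ * L * √(n : ℝ)) := by
  have := fun k => isProbabilityMeasure_cond_Icc (l := l k) hφ
  have := isProbabilityMeasure_cond_Ioc
  have hw := continuous_objectiveW a B
  have hcl := (isClosed_facetOptimal hbdd i).measurableSet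
  have hmeas : MeasurableSet {ω : (Fin n → ℝ) × (Fin n → ℝ) |
      WithLp.toLp 2 ω.1 - t • objectiveW a B ω.2 ∈ facetOptimal a b i ∧
        WithLp.toLp 2 ω.1 - t • objectiveW a B ω.2 + L • a i ∉ facetOptimal a b i} := by
    refine MeasurableSet.inter ?_ (MeasurableSet.compl ?_)
    · exact hcl.preimage (f := fun ω : (Fin n → ℝ) × (Fin n → ℝ) =>
        WithLp.toLp 2 ω.1 - t • objectiveW a B ω.2) (by fun_prop)
    · exact hcl.preimage (f := fun ω : (Fin n → ℝ) × (Fin n → ℝ) =>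
        WithLp.toLp 2 ω.1 - t • objectiveW a B ω.2 + L • a i) (by fun_prop)
  rw [randomLaw, Measure.prod_apply_symm hmeas]
  refine (lintegral_mono (g := fun _ => ENNReal.ofReal (φ * L * √(n : ℝ))) fun lam => ?_).trans
    (by simp)
  set D : Set (Fin n → ℝ) := {c | WithLp.toLp 2 c - t • objectiveW a B lam ∈ facetOptimal a b i}
  have hD : MeasurableSet D :=
    hcl.preimage (f := fun c : Fin n → ℝ => WithLp.toLp 2 c - t • objectiveW a B lam) (by fun_prop)
  have hshift : ∀ c : Fin n → ℝ, (WithLp.toLp 2 (c + fun k => L * a i k) : EuclideanSpace ℝ (Fin n))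
      - t • objectiveW a B lam = WithLp.toLp 2 c - t • objectiveW a B lam + L • a i := by
    intro c
    ext k
    simp
    ring
  have hDv : ∀ c : Fin n → ℝ, (c + fun k => L * a i k) ∈ D ↔
      WithLp.toLp 2 c - t • objectiveW a B lam + L • a i ∈ facetOptimal a b i := fun c => by
    rw [← hshift]; rfl
  calc _ = (Measure.pi fun k => cond volume (Set.Icc (l k) (l k + 1 / φ)) : Measure (Fin n → ℝ))
        {c | c ∈ D ∧ (c + fun k => L * a i k) ∉ D} := by
          congr 1
          ext c
          exact and_congr Iff.rfl (not_congr (hDv c).symm)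
    _ ≤ ∑ k, ENNReal.ofReal (φ * |L * a i k|) :=
        pi_cond_Icc_boundary_le l hφ hD _ fun c hc => facetOptimal_of_add_smul hL ((hDv c).1 hc)
    _ ≤ ENNReal.ofReal (φ * L * √(n : ℝ)) := by
        rw [← ENNReal.ofReal_sum_of_nonneg fun k _ => by positivity]
        refine ENNReal.ofReal_le_ofReal ?_
        simp only [abs_mul, abs_of_nonneg hL]
        rw [← Finset.mul_sum, ← Finset.mul_sum, mul_assoc]
        gcongr
        exact sum_abs_le_sqrt (ha i)

end ShadowVertex

theorem mainTheorem4 {m n : ℕ}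
    -- the linear program `max c₀ᵀx` subject to `A x ≤ b`, with normalized rows and objective
    (a : Fin m → EuclideanSpace ℝ (Fin n)) (b : Fin m → ℝ) (c₀ : EuclideanSpace ℝ (Fin n))
    (ha : ∀ i, ‖a i‖ = 1) (hc₀ : ‖c₀‖ = 1)
    (hbdd : Bornology.IsBounded (ShadowVertex.polyhedron a b))
    (hnd : ShadowVertex.Nondegenerate a b)
    -- `δ` is the largest number for which `A` satisfies the distance property
    (δ : ℝ) (hδ : IsGreatest {δ' : ℝ | ShadowVertex.DistanceProperty a δ'} δ)
    -- the initial basic feasible solution and `n` linearly independent rows tight at it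
    (x₀ : EuclideanSpace ℝ (Fin n)) (hx₀ : x₀ ∈ ShadowVertex.polyhedron a b)
    (B : Fin n → Fin m) (hB : LinearIndependent ℝ fun k => a (B k))
    (hBx₀ : ∀ k, inner ℝ (a (B k)) x₀ = b (B k))
    -- the intervals `[lₖ, lₖ + 1/φ] ⊆ [-1,1]` containing the coordinates of `c₀`
    (φ : ℝ) (hφ : √(n : ℝ) ≤ φ) (l : Fin n → ℝ)
    (hl : ∀ k, Set.Icc (l k) (l k + 1 / φ) ⊆ Set.Icc (-1) 1)
    (hlc₀ : ∀ k, c₀ k ∈ Set.Icc (l k) (l k + 1 / φ))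
    (t ε : ℝ) (ht : 0 ≤ t) (hε : 0 < ε) :
    (ShadowVertex.randomLaw l φ).real
        {ω | ∃ s ∈ Set.Ioc t (t + ε),
          ShadowVertex.HasSlope (ShadowVertex.objectiveW a B ω.2) (WithLp.toLp 2 ω.1)
            (ShadowVertex.polyhedron a b) s}
      ≤ 2 * m * (n : ℝ) ^ (3 / 2 : ℝ) * ε * φ / (max 1 (n * t / 2) * δ) ∧
    2 * m * (n : ℝ) ^ (3 / 2 : ℝ) * ε * φ / (max 1 (n * t / 2) * δ)
      ≤ 2 * m * (n : ℝ) ^ (3 / 2 : ℝ) * ε * φ / δ := by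
  have hn : 0 < n := by
    rcases Nat.eq_zero_or_pos n with rfl | h
    · rw [Subsingleton.elim c₀ 0, norm_zero] at hc₀
      exact absurd hc₀ zero_ne_one
    · exact h
  have hn' : (0 : ℝ) < n := Nat.cast_pos.2 hn
  have hφ0 : 0 < φ := (Real.sqrt_pos.2 hn').trans_le hφ
  have hδ0 : 0 < δ := ShadowVertex.distance_pos hδ
  set Q := max 1 (n * t / 2) with hQ
  have hQ1 : 1 ≤ Q := le_max_left _ _
  have hQ0 : 0 < Q := one_pos.trans_le hQ1
  refine ⟨?_, div_le_div_of_nonneg_left (by positivity) hδ0 (le_mul_of_one_le_left hδ0.le hQ1)⟩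
  -- The factor `2` leaves room for the strict inequality in `hbound`, as `W * Q ≤ n`.
  set L := 2 * ε * n / (Q * δ) with hL
  have hL0 : 0 < L := by positivity
  have hLδ : L * δ * Q = 2 * ε * n := by rw [hL]; field_simp
  have hbound : ∀ W : ℝ, 0 ≤ W → W ≤ n → t * W ≤ 2 → ε * W < L * δ := by
    intro W hW hWn htW
    refine lt_of_mul_lt_mul_right (a := Q) ?_ hQ0.le
    have hWQ : W * Q ≤ n := by
      rcases max_choice 1 (n * t / 2) with h | h <;> rw [hQ, h] <;> nlinarith
    rw [hLδ]
    nlinarith [mul_pos hε hn']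
  have hIcc := fun k => ShadowVertex.isProbabilityMeasure_cond_Icc (l := l k) hφ0
  have hIoc := ShadowVertex.isProbabilityMeasure_cond_Ioc
  have hfst : ∀ᵐ ω ∂(ShadowVertex.randomLaw l φ), ∀ k, ω.1 k ∈ Set.Icc (l k) (l k + 1 / φ) :=
    Measure.quasiMeasurePreserving_fst.ae
      (ShadowVertex.ae_pi_cond_mem fun _ => measurableSet_Icc)
  have hsnd : ∀ᵐ ω ∂(ShadowVertex.randomLaw l φ), ∀ k, ω.2 k ∈ Set.Ioc (0 : ℝ) 1 :=
    Measure.quasiMeasurePreserving_snd.ae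
      (ShadowVertex.ae_pi_cond_mem fun _ => measurableSet_Ioc)
  refine ENNReal.toReal_le_of_le_ofReal (by positivity) ?_
  calc _ ≤ ShadowVertex.randomLaw l φ (⋃ i, {ω |
        WithLp.toLp 2 ω.1 - t • ShadowVertex.objectiveW a B ω.2 ∈
            ShadowVertex.facetOptimal a b i ∧
          WithLp.toLp 2 ω.1 - t • ShadowVertex.objectiveW a B ω.2 + L • a i ∉
            ShadowVertex.facetOptimal a b i}) := by
        refine measure_mono_ae ?_
        filter_upwards [hfst, hsnd] with ω h1 h2
        rintro ⟨s, hs, hslope⟩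
        exact Set.mem_iUnion.2 (ShadowVertex.exists_facetOptimal_of_hasSlope hbdd hnd hδ.1 hδ0 ht hs
          (ShadowVertex.norm_objectiveW_le ha B h2)
          (ShadowVertex.norm_le_two hc₀ hφ0 hφ hlc₀ h1) hbound hslope)
    _ ≤ ∑ i : Fin m, ENNReal.ofReal (φ * L * √(n : ℝ)) :=
        (measure_iUnion_fintype_le _ _).trans (Finset.sum_le_sum fun i _ =>
          ShadowVertex.randomLaw_facetOptimal_le hbdd ha B l hφ0 t hL0.le i)
    _ = _ := by
        have hpow : (n : ℝ) ^ (3 / 2 : ℝ) = n * √(n : ℝ) := by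
          rw [Real.sqrt_eq_rpow, ← Real.rpow_one_add' hn'.le (by norm_num)]
          norm_num
        rw [Finset.sum_const, Finset.card_univ, Fintype.card_fin, nsmul_eq_mul,
          ← ENNReal.ofReal_natCast, ← ENNReal.ofReal_mul (by positivity), hpow, hL]
        congr 1
        ring
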